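/- Let $\widetilde{\mathfrak H}$ be a complex Hilbert space, let $\mathfrak H\subset\widetilde{\mathfrak H}$ be a closed subspace of finite codimension, i.e. $\dim(\widetilde{\mathfrak H}\ominus\mathfrak H)<\infty$, and let $P_{\mathfrak H}$ be the orthogonal projection of $\widetilde{\mathfrak H}$ onto $\mathfrak H$. A linear relation in a Hilbert space $\mathcal H$ is a linear subspace $T\subset\mathcal H\oplus\mathcal H$ (not necessarily closed); its adjoint is $$T^*=\{\{h,h'\}\in\mathcal H\oplus\mathcal H : (g',h)=(g,h')\ \text{for all}\ \{g,g'\}\in T\},$$ and $T$ is called self-adjoint if $T=T^*$. Let $\widetilde A=\widetilde A^*$ be a self-adjoint linear relation in $\widetilde{\mathfrak H}$. Then the compression $$C(\widetilde A)=P_{\mathfrak H}\widetilde A\upharpoonright\mathfrak H=\{\{f,f'\}\in\mathfrak H\oplus\mathfrak H : \{f,f'+f_r'\}\in\widetilde A\ \text{for some}\ f_r'\in\widetilde{\mathfrak H}\ominus\mathfrak H\}$$ is a self-adjoint linear relation in $\mathfrak H$, i.e. $C(\widetilde A)=C(\widetilde A)^*$, the adjoint being taken in $\mathfrak H$. -/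

import Mathlib

/-- A linear relation in `E`: a linear manifold in `E ⊕ E`, not assumed to be closed. An operator
is regarded as a linear relation through its graph. -/
abbrev LinearRelation (E : Type*) [NormedAddCommGroup E] [InnerProductSpace ℂ E] : Type _ :=
  Submodule ℂ (E × E)

namespace LinearRelation

variable {E : Type*} [NormedAddCommGroup E] [InnerProductSpace ℂ E]

/-- A linear relation is self-adjoint if it coincides with its adjoint relation
`{(h, h') | ⟪g', h⟫ = ⟪g, h'⟫ for all (g, g') in the relation}`. -/
def IsSelfAdjointRel (A : LinearRelation E) : Prop :=
  Submodule.adjoint A = A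

/-- The compression `P_H A ↾ H` of a linear relation `A` in `E` to the subspace `H`: restrict `A`
to first components in `H`, and project the second components orthogonally onto `H`. -/
noncomputable def compression (A : LinearRelation E) (H : Submodule ℂ E)
    [H.HasOrthogonalProjection] : LinearRelation H where
  carrier := {p | ∃ g : E, ((p.1 : E), g) ∈ A ∧ H.orthogonalProjectionOnto g = p.2}
  add_mem' := by
    rintro p q ⟨g, hg, hp⟩ ⟨k, hk, hq⟩
    exact ⟨g + k, by simpa using A.add_mem hg hk, by simp [hp, hq]⟩
  zero_mem' := ⟨0, A.zero_mem, map_zero _⟩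
  smul_mem' := by
    rintro c p ⟨g, hg, hp⟩
    exact ⟨c • g, by simpa using A.smul_mem c hg, by simp [hp]⟩

/-- `(f, f')` is in the compression iff `(f, f' + r) ∈ A` for some `r` orthogonal to `H`. -/
theorem mem_compression_iff (A : LinearRelation E) (H : Submodule ℂ E)
    [H.HasOrthogonalProjection] (f f' : H) :
    (f, f') ∈ A.compression H ↔ ∃ r ∈ Hᗮ, ((f : E), (f' : E) + r) ∈ A := by
  constructor
  · rintro ⟨g, hg, hp⟩
    refine ⟨g - f', ?_, by simpa using hg⟩
    have h := Submodule.sub_starProjection_mem_orthogonal (K := H) g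
    rw [Submodule.starProjection_apply, hp] at h
    exact h
  · rintro ⟨r, hr, hA⟩
    refine ⟨f' + r, hA, ?_⟩
    simpa [Submodule.orthogonalProjectionOnto_eq_zero_iff] using hr

end LinearRelation

namespace LinearRelation

/-! Symmetry passes to the compression since projecting onto `H` preserves inner products with
vectors of `H`. Conversely, if `(h, h')` is in the adjoint of the compression, `(a, b) ↦ ⟪h, b⟫ -
⟪h', a⟫` vanishes on pairs of `A` with `a ∈ H`. So on `A` it is `⟪k, a⟫` for some `k ∈ Hᗮ`, and `(h,
h' + k)` lies in the adjoint of `A`. -/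

/-- A linear functional which vanishes on the vectors of a linear manifold `A` that `π` maps
to zero, for `π` with values in a finite-dimensional space, is on `A` the inner product of `π`
with a fixed vector. -/
theorem exists_inner_eq_of_forall_eq_zero {V K : Type*} [AddCommGroup V] [Module ℂ V]
    [NormedAddCommGroup K] [InnerProductSpace ℂ K] [FiniteDimensional ℂ K]
    (A : Submodule ℂ V) (π : V →ₗ[ℂ] K) (φ : V →ₗ[ℂ] ℂ)
    (h : ∀ x ∈ A, π x = 0 → φ x = 0) :
    ∃ k : K, ∀ x ∈ A, φ x = inner ℂ k (π x) := by
  -- Vanishing on the kernel makes `φ` factor through `π` on `A`.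
  have hmem : φ.domRestrict A ∈ LinearMap.range (π.domRestrict A).dualMap := by
    rw [LinearMap.range_dualMap_eq_dualAnnihilator_ker, Submodule.mem_dualAnnihilator]
    intro x hx
    exact h x x.2 hx
  obtain ⟨ψ, hψ⟩ := hmem
  have : CompleteSpace K := FiniteDimensional.complete ℂ K
  -- Riesz applies because `ψ` is continuous in finite dimension.
  refine ⟨(InnerProductSpace.toDual ℂ K).symm (LinearMap.toContinuousLinearMap ψ), fun x hx ↦ ?_⟩
  rw [InnerProductSpace.toDual_symm_apply]
  exact (LinearMap.congr_fun hψ ⟨x, hx⟩).symm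

variable {E : Type*} [NormedAddCommGroup E] [InnerProductSpace ℂ E]

/-- The compression of a symmetric linear relation is symmetric. -/
theorem compression_le_adjoint (H : Submodule ℂ E) [H.HasOrthogonalProjection]
    (A : LinearRelation E) (hA : A ≤ Submodule.adjoint A) :
    A.compression H ≤ Submodule.adjoint (A.compression H) := by
  rintro ⟨h, h'⟩ ⟨g, hg, rfl⟩
  rw [Submodule.mem_adjoint_iff]
  rintro f f' ⟨k, hk, rfl⟩
  rw [Submodule.inner_orthogonalProjectionOnto_eq_of_mem_left,
    Submodule.inner_orthogonalProjectionOnto_eq_of_mem_right]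
  exact (Submodule.mem_adjoint_iff A _).1 (hA hg) _ _ hk

/-- The adjoint of the compression to a subspace of finite codimension is contained in the
compression of the adjoint. -/
theorem adjoint_compression_le (H : Submodule ℂ E) [H.HasOrthogonalProjection]
    [FiniteDimensional ℂ Hᗮ] (A : LinearRelation E) :
    Submodule.adjoint (A.compression H) ≤ compression (Submodule.adjoint A) H := by
  rintro ⟨h, h'⟩ hh
  rw [Submodule.mem_adjoint_iff] at hh
  obtain ⟨k, hk⟩ := exists_inner_eq_of_forall_eq_zero A
    (Hᗮ.orthogonalProjectionOnto.toLinearMap ∘ₗ LinearMap.fst ℂ E E)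
    (innerₛₗ ℂ (h : E) ∘ₗ LinearMap.snd ℂ E E - innerₛₗ ℂ (h' : E) ∘ₗ LinearMap.fst ℂ E E) (by
      rintro ⟨a, b⟩ hab ha
      have haH : a ∈ H := by
        simpa [Submodule.orthogonalProjectionOnto_eq_zero_iff,
          Submodule.orthogonal_orthogonal] using ha
      have := hh ⟨a, haH⟩ (H.orthogonalProjectionOnto b) ⟨b, hab, rfl⟩
      rw [Submodule.inner_orthogonalProjectionOnto_eq_of_mem_right, Submodule.coe_inner] at this
      simpa using congrArg (starRingEnd ℂ) this)
  rw [mem_compression_iff]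
  refine ⟨k, k.2, ?_⟩
  rw [Submodule.mem_adjoint_iff]
  intro a b hab
  have := hk _ hab
  simp only [LinearMap.sub_apply, LinearMap.comp_apply, LinearMap.fst_apply, LinearMap.snd_apply,
    innerₛₗ_apply_apply, ContinuousLinearMap.coe_coe,
    Submodule.inner_orthogonalProjectionOnto_eq_of_mem_left] at this
  have h0 : inner ℂ (h : E) b - inner ℂ ((h' : E) + k) a = 0 := by
    rw [inner_add_left, ← this]; ring
  simpa [inner_add_right, inner_add_left] using congrArg (starRingEnd ℂ) h0

end LinearRelation

/-- Completeness of `H` says that `H` is a closed subspace of `E`. -/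
theorem corollary3p26 {E : Type*} [NormedAddCommGroup E] [InnerProductSpace ℂ E] [CompleteSpace E]
    (H : Submodule ℂ E) [CompleteSpace H] (hcodim : FiniteDimensional ℂ Hᗮ)
    (A : LinearRelation E) (hA : A.IsSelfAdjointRel) :
    (A.compression H).IsSelfAdjointRel :=
  le_antisymm ((LinearRelation.adjoint_compression_le H A).trans_eq (by rw [hA]))
    (LinearRelation.compression_le_adjoint H A hA.ge)
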